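/- Let $0<p<1$ and let $\theta_1,\dots,\theta_4$ be the Jacobi theta functions with nome $p$: $\theta_1(z)=2p^{1/4}\sin z\prod_{n\ge1}(1-p^{2n})(1-2p^{2n}\cos 2z+p^{4n})$, $\theta_2(z)=2p^{1/4}\cos z\prod_{n\ge1}(1-p^{2n})(1+2p^{2n}\cos 2z+p^{4n})$, $\theta_3(z)=\prod_{n\ge1}(1-p^{2n})(1+2p^{2n-1}\cos 2z+p^{4n-2})$, $\theta_4(z)=\prod_{n\ge1}(1-p^{2n})(1-2p^{2n-1}\cos 2z+p^{4n-2})$. Let $M\in\{0,1,2,\dots\}$ and let $u_r,v_r\in\mathbb R$ ($1\le r\le4$) satisfy $u_r>0$ and $|v_r|<u_r+\frac12$ for $r=1,2$. Put $\alpha=\pi/(u_1+u_2+M)$, and let $u\in\mathbb R$ be such that $u,u+1\notin\frac{2\pi}{\alpha}\mathbb Z$. Put $[z]_1=\theta_1(\frac\alpha2z)/(\frac\alpha2\theta_1'(0))$ and $[z]_r=\theta_r(\frac\alpha2z)/\theta_r(0)$ for $r=2,3,4$. Let $\pi_1=\mathrm{id}$, $\pi_2=(12)(34)$, $\pi_3=(13)(24)$,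 $\pi_4=(14)(23)$, and $$A(z)=\prod_{r=1}^4\frac{[z+u_r]_r}{[z]_r}\frac{[z+\frac12+v_r]_r}{[z+\frac12]_r},\qquad B(z)=\sum_{r=1}^4c_r\frac{[z+\frac12+u]_r}{[z+\frac12]_r}\frac{[z-\frac12-u]_r}{[z-\frac12]_r},$$ $$c_r=\frac{2}{[u]_1[u+1]_1}\prod_{s=1}^4[u_{\pi_r(s)}-\tfrac12]_s\,[v_{\pi_r(s)}]_s .$$ Put $a_k=A(-u_1-k)$ and $\tilde a_k=A(u_1+M-k)$ for $1\le k\le M$, and $b_k=B(u_1+k)$ for $0\le k\le M$. (A quotient with zero denominator in $b_k$ is read as $0$; for $M\ge1$ this occurs only in terms with $c_r=0$.) These numbers satisfy $a_k\ne0$ and $\tilde a_k\neq0$. The finite discrete Heun equation, for $\mathrm E\in\mathbb C$ and $f_0,\dots,f_M\in\mathbb C$, is $$\tilde a_{M-k}f_{k+1}+a_kf_{k-1}+b_kf_k=\mathrm E f_k\qquad(k=0,\dots,M),$$ where the terms containing $f_{-1}$ and $f_{M+1}$ are absent. Let $p_0=1$ and, for $1\le k\le M+1$, let $p_k(\mathrm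 E)$ be the determinant of the tridiagonal $k\times k$ matrix with diagonal entries $\mathrm E-b_i$ ($0\le i<k$), entries $-\tilde a_{M-i}$ in position $(i,i+1)$ and $-a_{i+1}$ in position $(i+1,i)$ ($0\le i<k-1$). A tilde on $p_k$, $\mathrm E_j$, $h_k$ denotes the same object with the parameters permuted: $(u_1,v_1)\leftrightarrow(u_2,v_2)$ and $(u_3,v_3)\leftrightarrow(u_4,v_4)$. **Theorem 3.6 (Finite Discrete Heun Function).** (i) The polynomial $p_{M+1}$ has $M+1$ distinct roots, all real, $\mathrm E_0>\mathrm E_1>\dots>\mathrm E_M$, and for $\mathrm E\in\mathbb C$ the finite discrete Heun equation has a nontrivial solution if and only if $\mathrm E\in\{\mathrm E_0,\dots,\mathrm E_M\}$. (ii) For $\mathrm E=\mathrm E_j$ the solutions are exactly the complex multiples of the (nontrivial) solution $$h_k(\mathrm E_j)=h_0(\mathrm E_j)\,p_k(\mathrm E_j)\prod_{0\le i<k}\tilde a_{M-i}^{-1}\quad(k=0,\dots,M),\qquad h_0(\mathrm E_j)=|\epsilon_j|^{1/2}=\left|\frac{\tilde a_1\cdots\tilde a_M}{p_M(\mathrm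 E_j)}\right|^{1/2},$$ where $\epsilon_j=\tilde p_M(\mathrm E_j)/(a_1\cdots a_M)$ and $p_M(\mathrm E_j)\ne0$. (iii) $\tilde h_k(\tilde{\mathrm E}_j)=(-1)^jh_{M-k}(\mathrm E_j)$ and $\tilde{\mathrm E}_j=\mathrm E_j$ for $0\le j,k\le M$. (iv) Put $w_k=\prod_{1\le i\le k}\tilde a_{M+1-i}\prod_{k+1\le i\le M}a_i$. For $0\le i,j\le M$, $$\sum_{k=0}^Mh_k(\mathrm E_i)h_k(\mathrm E_j)\,w_k=\begin{cases}\prod_{0\le l\le M,\,l\ne j}|\mathrm E_j-\mathrm E_l|&\text{if }i=j,\\0&\text{if }i\neq j,\end{cases}$$ and for $0\le l,k\le M$, $$\sum_{j=0}^M\frac{h_l(\mathrm E_j)h_k(\mathrm E_j)}{\prod_{0\le i\le M,\,i\neq j}|\mathrm E_j-\mathrm E_i|}=\begin{cases}w_k^{-1}&\text{if }l=k,\\0&\text{if }l\ne k.\end{cases}$$ -/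

import Mathlib

open Polynomial

noncomputable section

namespace DiscreteHeun

/-- Jacobi's theta function `θ₁(z; p)` with nome `p`, by its product formula. -/
def theta1 (p z : ℝ) : ℝ :=
  2 * p ^ (1 / 4 : ℝ) * Real.sin z *
    ∏' n : ℕ, (1 - p ^ (2 * (n + 1))) *
      (1 - 2 * p ^ (2 * (n + 1)) * Real.cos (2 * z) + p ^ (4 * (n + 1)))

/-- Jacobi's theta function `θ₂(z; p)`. -/
def theta2 (p z : ℝ) : ℝ :=
  2 * p ^ (1 / 4 : ℝ) * Real.cos z *
    ∏' n : ℕ, (1 - p ^ (2 * (n + 1))) *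
      (1 + 2 * p ^ (2 * (n + 1)) * Real.cos (2 * z) + p ^ (4 * (n + 1)))

/-- Jacobi's theta function `θ₃(z; p)`. -/
def theta3 (p z : ℝ) : ℝ :=
  ∏' n : ℕ, (1 - p ^ (2 * (n + 1))) *
    (1 + 2 * p ^ (2 * n + 1) * Real.cos (2 * z) + p ^ (4 * n + 2))

/-- Jacobi's theta function `θ₄(z; p)`. -/
def theta4 (p z : ℝ) : ℝ :=
  ∏' n : ℕ, (1 - p ^ (2 * (n + 1))) *
    (1 - 2 * p ^ (2 * n + 1) * Real.cos (2 * z) + p ^ (4 * n + 2))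

/-- The scaled theta functions `[z]_r` (`r = 1, …, 4` is the index `0, …, 3` of `Fin 4`):
`[z]₁ = θ₁(αz/2) / ((α/2) θ₁'(0))` and `[z]_r = θ_r(αz/2) / θ_r(0)` for `r = 2, 3, 4`. -/
def bracket (p α : ℝ) : Fin 4 → ℝ → ℝ :=
  ![fun z => theta1 p (α / 2 * z) / (α / 2 * deriv (theta1 p) 0),
    fun z => theta2 p (α / 2 * z) / theta2 p 0,
    fun z => theta3 p (α / 2 * z) / theta3 p 0,
    fun z => theta4 p (α / 2 * z) / theta4 p 0]

/-- The permutations `π₁ = id`, `π₂ = (12)(34)`, `π₃ = (13)(24)`, `π₄ = (14)(23)` of the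
parameter indices. -/
def perm : Fin 4 → Equiv.Perm (Fin 4) :=
  ![1, Equiv.swap 0 1 * Equiv.swap 2 3, Equiv.swap 0 2 * Equiv.swap 1 3,
    Equiv.swap 0 3 * Equiv.swap 1 2]

/-- The data of a finite discrete Heun equation: the nome `p`, the virtual parameter `u`, the
truncation parameter `M`, and the couplings `u_r = U (r - 1)`, `v_r = V (r - 1)`. -/
structure Params where
  p : ℝ
  u : ℝ
  M : ℕ
  U : Fin 4 → ℝ
  V : Fin 4 → ℝ

namespace Params

variable (P : Params)

/-- The scaling parameter `α = π / (u₁ + u₂ + M)`. -/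
def α : ℝ := Real.pi / (P.U 0 + P.U 1 + P.M)

/-- The standing assumptions on the parameters. -/
structure Admissible : Prop where
  p_pos : 0 < P.p
  p_lt_one : P.p < 1
  U_pos : ∀ r : Fin 4, r = 0 ∨ r = 1 → 0 < P.U r
  V_lt : ∀ r : Fin 4, r = 0 ∨ r = 1 → |P.V r| < P.U r + 1 / 2
  u_ne : ∀ n : ℤ, P.u ≠ 2 * Real.pi / P.α * n
  u_add_one_ne : ∀ n : ℤ, P.u + 1 ≠ 2 * Real.pi / P.α * n

/-- The action of `π₂` on the couplings: `u₁ ↔ u₂`, `u₃ ↔ u₄`, `v₁ ↔ v₂`, `v₃ ↔ v₄`. -/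
def swap : Params where
  p := P.p
  u := P.u
  M := P.M
  U := fun r => P.U (perm 1 r)
  V := fun r => P.V (perm 1 r)

/-- The scaled theta function `[z]_{r+1}` with the nome and the scale of `P`. -/
def br (r : Fin 4) (z : ℝ) : ℝ := bracket P.p P.α r z

/-- The coefficient `A(z)` of the difference Heun operator. -/
def A (z : ℝ) : ℝ :=
  ∏ r : Fin 4, (P.br r (z + P.U r) / P.br r z *
    (P.br r (z + 1 / 2 + P.V r) / P.br r (z + 1 / 2)))

/-- The constants `c_r`. -/
def c (r : Fin 4) : ℝ :=
  2 / (P.br 0 P.u * P.br 0 (P.u + 1)) *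
    ∏ s : Fin 4, (P.br s (P.U (perm r s) - 1 / 2) * P.br s (P.V (perm r s)))

/-- The coefficient `B(z)` of the difference Heun operator. -/
def B (z : ℝ) : ℝ :=
  ∑ r : Fin 4, P.c r * (P.br r (z + 1 / 2 + P.u) / P.br r (z + 1 / 2)) *
    (P.br r (z - 1 / 2 - P.u) / P.br r (z - 1 / 2))

/-- `a_k = A(-u₁ - k)`. -/
def a (k : ℕ) : ℝ := P.A (-P.U 0 - k)

/-- `ã_k = A(u₁ + M - k)`. -/
def aTilde (k : ℕ) : ℝ := P.A (P.U 0 + P.M - k)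

/-- `b_k = B(u₁ + k)`. -/
def b (k : ℕ) : ℝ := P.B (P.U 0 + k)

/-- The finite discrete Heun equation
`ã_{M-k} f_{k+1} + a_k f_{k-1} + b_k f_k = E f_k`, `k = 0, …, M`, where the terms with `f_{-1}`
and `f_{M+1}` are absent. -/
def IsSolution (E : ℂ) (f : Fin (P.M + 1) → ℂ) : Prop :=
  ∀ k : Fin (P.M + 1),
    (if h : (k : ℕ) < P.M then (P.aTilde (P.M - k) : ℂ) * f ⟨k + 1, by omega⟩ else 0) +
      (if 0 < (k : ℕ) then (P.a k : ℂ) * f ⟨k - 1, by omega⟩ else 0) +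
      (P.b k : ℂ) * f k = E * f k

/-- The leading `k × k` block of the tridiagonal matrix of the finite discrete Heun equation
(the whole matrix for `k = M + 1`). -/
def block (k : ℕ) : Matrix (Fin k) (Fin k) ℝ :=
  Matrix.of fun i j =>
    if (i : ℕ) = j then P.b i
    else if (j : ℕ) = i + 1 then P.aTilde (P.M - i)
    else if (i : ℕ) = j + 1 then P.a i
    else 0

/-- The monic elliptic Racah polynomial `p_k(E)`: the determinant of the leading `k × k` block of
`E - H`. -/
def racah (k : ℕ) : ℝ[X] := (P.block k).charpoly

/-- `ε = p̃_M(E) / (a₁ ⋯ a_M)`, where `p̃_M` has permuted couplings. -/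
def eps (E : ℝ) : ℝ := (P.swap.racah P.M).eval E / ∏ j ∈ Finset.Icc 1 P.M, P.a j

/-- The finite discrete Heun function
`h_k(E) = |ε|^{1/2} p_k(E) ∏_{0 ≤ j < k} ã_{M-j}⁻¹`. -/
def heun (E : ℝ) (k : ℕ) : ℝ :=
  √|P.eps E| * (P.racah k).eval E * ∏ j ∈ Finset.range k, (P.aTilde (P.M - j))⁻¹

/-- `∏_{1 ≤ j ≤ k} ã_{M+1-j} ∏_{k+1 ≤ j ≤ M} a_j`. -/
def weight (k : ℕ) : ℝ :=
  (∏ j ∈ Finset.Icc 1 k, P.aTilde (P.M + 1 - j)) * ∏ j ∈ Finset.Icc (k + 1) P.M, P.a j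

/-- `E₀ > E₁ > ⋯ > E_M` are the roots, all of them real and simple, of the top-degree elliptic
Racah polynomial `p_{M+1}`. -/
def IsSpectrum (E : Fin (P.M + 1) → ℝ) : Prop :=
  StrictAnti E ∧ P.racah (P.M + 1) = ∏ j, (X - C (E j))

end Params

end DiscreteHeun

end

noncomputable section

open scoped Matrix

/-!
The finite discrete Heun equation is the eigenvalue equation of a tridiagonal matrix. On the range
of arguments that enter `ã_k` every theta quotient in `A` is positive, and the shift by the
half-period `u₁ + u₂ + M` exchanges `θ₁ ↔ θ₂` and `θ₃ ↔ θ₄`; hence permuting the couplings reverses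
the order of the sites, and `a_k > 0` follows from `ã_k > 0`. The matrix is therefore similar to a
real symmetric one with nonvanishing couplings. The Christoffel–Darboux identity gives the
simplicity of the spectrum, the orthogonality of the eigenvectors, and the norm of each
eigenvector as the product of its last component and `p_{M+1}'(E_j)`; the sign `(-1)^j` of that
derivative is the sign of the last component. Reversing the sites replaces an eigenvector with
first component `1` by its multiple with last component `1`, so the two last components are
mutually inverse, and this is what the factor `|ε_j|^{1/2}` symmetrizes.
-/

theorem exists_strictAnti_eq_prod_X_sub_C {K : Type*} [Field K] [LinearOrder K] {p : K[X]} {n : ℕ}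
    (hmonic : p.Monic) (hsplits : p.Splits) (hnodup : p.roots.Nodup) (hdeg : p.natDegree = n) :
    ∃ E : Fin n → K, StrictAnti E ∧ p = ∏ j, (X - C (E j)) := by
  have hcard : p.roots.toFinset.card = n := by
    rw [Multiset.toFinset_card_of_nodup hnodup, ← hsplits.natDegree_eq_card_roots, hdeg]
  let e := p.roots.toFinset.orderEmbOfFin hcard
  refine ⟨fun j => e j.rev, fun i j hij => e.strictMono (Fin.rev_lt_rev.2 hij), ?_⟩
  calc
    p = ∏ x ∈ p.roots.toFinset, (X - C x) := by
      rw [Finset.prod, Multiset.toFinset_val, hnodup.dedup]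
      exact hsplits.eq_prod_roots_of_monic hmonic
    _ = ∏ j, (X - C (e j)) := by
      rw [← Finset.image_orderEmbOfFin_univ _ hcard, Finset.prod_image e.injective.injOn]
    _ = ∏ j : Fin n, (X - C (e j.rev)) := (Equiv.prod_comp Fin.revPerm fun j => X - C (e j)).symm

theorem prod_erase_sub_eq_neg_one_pow_mul {n : ℕ} {E : Fin n → ℝ} (hE : StrictAnti E) (j : Fin n) :
    ∏ l ∈ Finset.univ.erase j, (E j - E l) =
      (-1) ^ (j : ℕ) * ∏ l ∈ Finset.univ.erase j, |E j - E l| := by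
  have hfactor (l) (hl : l ∈ Finset.univ.erase j) :
      E j - E l = (if l < j then -1 else 1) * |E j - E l| := by
    rcases lt_or_gt_of_ne (Finset.ne_of_mem_erase hl) with h | h
    · rw [if_pos h, abs_of_neg (sub_neg.2 (hE h)), neg_one_mul, neg_neg]
    · rw [if_neg h.not_gt, abs_of_pos (sub_pos.2 (hE h)), one_mul]
  have hfilter : (Finset.univ.erase j).filter (· < j) = Finset.Iio j := by
    ext l
    simpa using fun h : l < j => h.ne
  rw [Finset.prod_congr rfl hfactor, Finset.prod_mul_distrib, Finset.prod_ite, hfilter]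
  simp

theorem prod_erase_abs_sub_pos {ι : Type*} [Fintype ι] [DecidableEq ι] {E : ι → ℝ}
    (hE : Function.Injective E) (j : ι) : 0 < ∏ l ∈ Finset.univ.erase j, |E j - E l| :=
  Finset.prod_pos fun _ hl => abs_pos.2 (sub_ne_zero.2 (hE.ne (Finset.ne_of_mem_erase hl).symm))

theorem eval_derivative_prod_X_sub_C {R ι : Type*} [CommRing R] [Fintype ι] [DecidableEq ι]
    (E : ι → R) (j : ι) :
    (derivative (∏ l, (X - C (E l)))).eval (E j) = ∏ l ∈ Finset.univ.erase j, (E j - E l) := by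
  simpa [Lagrange.nodal, eval_prod] using
    Lagrange.eval_nodal_derivative_eval_node_eq (v := E) (Finset.mem_univ j)

/-- Dual orthogonality: a left inverse of a square matrix is a right inverse. -/
theorem sum_mul_div_eq_of_sum_mul_mul_eq {K ι : Type*} [Field K] [Fintype ι] [DecidableEq ι]
    {h : ι → ι → K} {w N : ι → K} (hN : ∀ j, N j ≠ 0)
    (horth : ∀ i j, ∑ k, h i k * h j k * w k = if i = j then N j else 0) (l k : ι) :
    ∑ j, h j l * h j k / N j = if l = k then (w k)⁻¹ else 0 := by
  have hleft : (Matrix.of fun i k => (N i)⁻¹ * h i k * w k) * (Matrix.of h).transpose = 1 := by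
    ext i j
    calc
      ∑ k, (N i)⁻¹ * h i k * w k * h j k = (N i)⁻¹ * ∑ k, h i k * h j k * w k := by
        rw [Finset.mul_sum]
        exact Finset.sum_congr rfl fun k _ => by ring
      _ = (1 : Matrix ι ι K) i j := by
        rw [horth, Matrix.one_apply]
        split_ifs with hij
        · rw [hij, inv_mul_cancel₀ (hN j)]
        · rw [mul_zero]
  have hright (l k : ι) : (∑ j, h j l * h j k / N j) * w k = if l = k then 1 else 0 := by
    rw [← Matrix.one_apply, ← mul_eq_one_comm.1 hleft, Matrix.mul_apply, Finset.sum_mul]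
    exact Finset.sum_congr rfl fun j _ => by
      simp only [Matrix.transpose_apply, Matrix.of_apply]
      ring
  have hw : w k ≠ 0 := right_ne_zero_of_mul_eq_one ((hright k k).trans (if_pos rfl))
  rw [eq_div_of_mul_eq hw (hright l k), ite_div, zero_div, one_div]

theorem exists_mulVec_eq_smul_iff_isRoot_charpoly {K ι : Type*} [Field K] [Fintype ι]
    [DecidableEq ι] (A : Matrix ι ι K) (e : K) :
    (∃ f ≠ 0, A *ᵥ f = e • f) ↔ A.charpoly.IsRoot e := by
  rw [IsRoot.def, Matrix.eval_charpoly, ← Matrix.exists_mulVec_eq_zero_iff]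
  simp only [Matrix.sub_mulVec, Matrix.scalar_apply, ← Matrix.smul_one_eq_diagonal,
    Matrix.smul_mulVec, Matrix.one_mulVec, sub_eq_zero, eq_comm]

theorem hasDerivAt_mul_of_eq_zero {𝕜 : Type*} [NontriviallyNormedField 𝕜] {f g : 𝕜 → 𝕜}
    {f' a : 𝕜} (hf : HasDerivAt f f' a) (hfa : f a = 0) (hg : ContinuousAt g a) :
    HasDerivAt (fun x => f x * g x) (f' * g a) a := by
  rw [hasDerivAt_iff_tendsto_slope] at hf ⊢
  refine (hf.mul (hg.tendsto.mono_left nhdsWithin_le_nhds)).congr fun x => ?_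
  simp only [slope_def_field, hfa]
  ring

/-- The data of a tridiagonal operator `f ↦ (k ↦ supₖ fₖ₊₁ + diagₖ fₖ + subₖ fₖ₋₁)` on sequences.
The entry `sub 0` plays no role. -/
structure Tridiagonal (R : Type*) where
  diag : ℕ → R
  sup : ℕ → R
  sub : ℕ → R

namespace Tridiagonal

section CommRing

variable {R S : Type*} [CommRing R] [CommRing S] (T : Tridiagonal R)

/-- The matrix entries of a tridiagonal operator. -/
def entry (i j : ℕ) : R :=
  if i = j then T.diag i else if j = i + 1 then T.sup i else if i = j + 1 then T.sub i else 0

/-- The leading `n × n` block of a tridiagonal operator. -/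
def matrix (n : ℕ) : Matrix (Fin n) (Fin n) R :=
  Matrix.of fun i j => T.entry i j

/-- The orthogonal polynomials of a tridiagonal operator, up to normalization: the characteristic
polynomials of its leading blocks. -/
def poly (n : ℕ) : R[X] := (T.matrix n).charpoly

/-- The product of the off-diagonal entries linking the sites `k` and `k + 1`. -/
def coupling (k : ℕ) : R := T.sup k * T.sub (k + 1)

/-- Entrywise image of a tridiagonal operator under a ring homomorphism. -/
def map (φ : R →+* S) : Tridiagonal S where
  diag k := φ (T.diag k)
  sup k := φ (T.sup k)
  sub k := φ (T.sub k)

@[simp]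
theorem matrix_apply {n : ℕ} (i j : Fin n) : T.matrix n i j = T.entry i j := rfl

@[simp]
theorem entry_self (i : ℕ) : T.entry i i = T.diag i := by simp [entry]

@[simp]
theorem entry_succ_right (i : ℕ) : T.entry i (i + 1) = T.sup i := by simp [entry]

@[simp]
theorem entry_succ_left (i : ℕ) : T.entry (i + 1) i = T.sub (i + 1) := by
  simp [entry, show i ≠ i + 1 + 1 by omega]

theorem entry_eq_zero {i j : ℕ} (h : i + 1 < j ∨ j + 1 < i) : T.entry i j = 0 := by
  rw [entry, if_neg (by omega), if_neg (by omega), if_neg (by omega)]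

theorem submatrix_matrix_castSucc (n : ℕ) :
    (T.matrix (n + 1)).submatrix Fin.castSucc Fin.castSucc = T.matrix n := rfl

theorem det_submatrix_matrix_add_two (k : ℕ) :
    ((T.matrix (k + 2)).submatrix Fin.castSucc (Fin.last k).castSucc.succAbove).det =
      T.sup k * (T.matrix k).det := by
  have hcol (i : Fin k) :
      (Fin.last k).castSucc.succAbove i.castSucc = i.castSucc.castSucc :=
    Fin.succAbove_castSucc_of_lt _ _ (Fin.castSucc_lt_last i)
  have hblock : ((T.matrix (k + 2)).submatrix Fin.castSucc
      (Fin.last k).castSucc.succAbove).submatrix Fin.castSucc Fin.castSucc = T.matrix k := by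
    ext i j
    simp [hcol]
  rw [Matrix.det_succ_column _ (Fin.last k), Fin.sum_univ_castSucc, Finset.sum_eq_zero]
  · simp [hblock, Fin.succAbove_last]
  · intro i _
    simp [T.entry_eq_zero (Or.inl (Nat.succ_lt_succ i.is_lt))]

theorem det_matrix_add_two (k : ℕ) :
    (T.matrix (k + 2)).det =
      T.diag (k + 1) * (T.matrix (k + 1)).det - T.coupling k * (T.matrix k).det := by
  rw [Matrix.det_succ_row _ (Fin.last (k + 1)), Fin.sum_univ_castSucc, Fin.sum_univ_castSucc,
    Finset.sum_eq_zero]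
  · have hodd : (-1 : R) ^ (k + 1 + k) = -1 := Odd.neg_one_pow ⟨k, by ring⟩
    simp only [Fin.succAbove_last, det_submatrix_matrix_add_two, submatrix_matrix_castSucc,
      matrix_apply, Fin.val_last, Fin.val_castSucc, entry_self, entry_succ_left, hodd,
      Even.neg_one_pow ⟨k + 1, rfl⟩, coupling]
    ring
  · intro j _
    simp [T.entry_eq_zero (Or.inr (Nat.succ_lt_succ j.is_lt))]

/-- The operator `X - T`, over the polynomial ring. -/
def charOperator : Tridiagonal R[X] where
  diag k := X - C (T.diag k)
  sup k := -C (T.sup k)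
  sub k := -C (T.sub k)

theorem charmatrix_matrix (n : ℕ) : (T.matrix n).charmatrix = T.charOperator.matrix n := by
  ext1 i j
  simp only [Matrix.charmatrix_apply, Matrix.diagonal_apply, matrix_apply, entry, charOperator,
    Fin.ext_iff]
  split_ifs <;> simp

@[simp]
theorem poly_zero : T.poly 0 = 1 := by simp [poly, Matrix.charpoly]

theorem poly_one : T.poly 1 = X - C (T.diag 0) := by
  simp [poly, Matrix.charpoly, charmatrix_matrix, charOperator]

theorem poly_add_two (k : ℕ) :
    T.poly (k + 2) = (X - C (T.diag (k + 1))) * T.poly (k + 1) - C (T.coupling k) * T.poly k := by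
  simp only [poly, Matrix.charpoly, charmatrix_matrix, det_matrix_add_two]
  simp [charOperator, coupling]

theorem map_matrix (φ : R →+* S) (n : ℕ) : (T.map φ).matrix n = (T.matrix n).map φ := by
  ext i j
  simp only [matrix_apply, entry, map, Matrix.map_apply, apply_ite φ, map_zero]

theorem poly_map (φ : R →+* S) (n : ℕ) : (T.map φ).poly n = (T.poly n).map φ := by
  rw [poly, map_matrix, Matrix.charpoly_map, poly]

theorem poly_congr {T T' : Tridiagonal R} {n : ℕ} (hdiag : T.diag = T'.diag)
    (hcoupling : ∀ i, i + 1 < n → T.coupling i = T'.coupling i) : T.poly n = T'.poly n := by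
  induction n using Nat.twoStepInduction with
  | zero => simp
  | one => rw [poly_one, poly_one, hdiag]
  | more k ih ih' =>
    rw [poly_add_two, poly_add_two, ih fun i hi => hcoupling i (by omega),
      ih' fun i hi => hcoupling i (by omega), hdiag, hcoupling k (by omega)]

/-- The Christoffel–Darboux kernel, cleared of denominators. -/
def kernel (n : ℕ) (x y : R) : R :=
  ∑ k ∈ Finset.range (n + 1),
    (T.poly k).eval x * (T.poly k).eval y * ∏ i ∈ Finset.Ico k n, T.coupling i

theorem kernel_succ (n : ℕ) (x y : R) :
    T.kernel (n + 1) x y =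
      T.coupling n * T.kernel n x y + (T.poly (n + 1)).eval x * (T.poly (n + 1)).eval y := by
  unfold kernel
  rw [Finset.sum_range_succ, Finset.Ico_self, Finset.prod_empty, mul_one, Finset.mul_sum]
  congr 1
  refine Finset.sum_congr rfl fun k hk => ?_
  rw [Finset.prod_Ico_succ_top (Nat.le_of_lt_succ (Finset.mem_range.1 hk))]
  ring

theorem sub_mul_kernel (n : ℕ) (x y : R) :
    (x - y) * T.kernel n x y =
      (T.poly (n + 1)).eval x * (T.poly n).eval y -
        (T.poly n).eval x * (T.poly (n + 1)).eval y := by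
  induction n with
  | zero => simp [kernel, poly_one]
  | succ n ih =>
    rw [kernel_succ, poly_add_two]
    simp only [eval_sub, eval_mul, eval_X, eval_C]
    linear_combination T.coupling n * ih

theorem kernel_self (n : ℕ) (x : R) :
    T.kernel n x x =
      (derivative (T.poly (n + 1))).eval x * (T.poly n).eval x -
        (derivative (T.poly n)).eval x * (T.poly (n + 1)).eval x := by
  induction n with
  | zero => simp [kernel, poly_one]
  | succ n ih =>
    rw [kernel_succ, ih, poly_add_two]
    simp only [derivative_sub, derivative_mul, derivative_X, derivative_C, eval_add, eval_sub,
      eval_mul, eval_X, eval_C, eval_one, eval_zero]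
    ring

theorem mulVec_apply {n : ℕ} (f : Fin (n + 1) → R) (k : Fin (n + 1)) :
    (T.matrix (n + 1) *ᵥ f) k =
      (if h : (k : ℕ) < n then T.sup k * f ⟨k + 1, by omega⟩ else 0) +
        (if 0 < (k : ℕ) then T.sub k * f ⟨k - 1, by omega⟩ else 0) + T.diag k * f k := by
  have hentry (j : Fin (n + 1)) : T.entry k j * f j =
      (if (j : ℕ) = k + 1 then T.sup k * f j else 0) +
        (if (k : ℕ) = j + 1 then T.sub k * f j else 0) +
          if k = j then T.diag k * f j else 0 := by
    simp only [entry, Fin.ext_iff]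
    split_ifs <;> first | omega | simp
  have hsup : ∑ j : Fin (n + 1), (if (j : ℕ) = k + 1 then T.sup k * f j else 0) =
      if h : (k : ℕ) < n then T.sup k * f ⟨k + 1, by omega⟩ else 0 := by
    split_ifs with hk
    · rw [Finset.sum_eq_single ⟨k + 1, by omega⟩] <;> simp +contextual [Fin.ext_iff]
    · exact Finset.sum_eq_zero fun j _ => if_neg (by omega)
  have hsub : ∑ j : Fin (n + 1), (if (k : ℕ) = j + 1 then T.sub k * f j else 0) =
      if 0 < (k : ℕ) then T.sub k * f ⟨k - 1, by omega⟩ else 0 := by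
    split_ifs with hk
    · rw [Finset.sum_eq_single ⟨k - 1, by omega⟩]
      · simp [Nat.sub_add_cancel hk]
      · intro j _ hj
        exact if_neg fun h => hj (Fin.ext (by simp [h]))
      · simp
    · exact Finset.sum_eq_zero fun j _ => if_neg (by omega)
  simp only [Matrix.mulVec, dotProduct, matrix_apply, hentry, Finset.sum_add_distrib, hsup, hsub,
    Finset.sum_ite_eq, Finset.mem_univ, if_true]

end CommRing

section Real

variable {T : Tridiagonal ℝ} {n : ℕ}

theorem splits_poly (hcoupling : ∀ i, i + 1 < n → 0 ≤ T.coupling i) : (T.poly n).Splits := by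
  let S : Tridiagonal ℝ := ⟨T.diag, fun k => √(T.coupling k), fun k => √(T.coupling (k - 1))⟩
  have hS : (S.matrix n).IsHermitian := by
    ext i j
    simp only [Matrix.conjTranspose_apply, matrix_apply, entry, star_trivial, S]
    grind
  have hpoly : T.poly n = S.poly n :=
    poly_congr rfl fun i hi => (Real.mul_self_sqrt (hcoupling i hi)).symm
  rw [hpoly]
  exact hS.splits_charpoly

theorem kernel_self_pos (hcoupling : ∀ i < n, 0 < T.coupling i) (x : ℝ) : 0 < T.kernel n x x := by
  have hprod (k : ℕ) : 0 < ∏ i ∈ Finset.Ico k n, T.coupling i :=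
    Finset.prod_pos fun i hi => hcoupling i (Finset.mem_Ico.1 hi).2
  refine Finset.sum_pos' (fun k _ => mul_nonneg (mul_self_nonneg _) (hprod k).le) ⟨0, by simp, ?_⟩
  simpa using hprod 0

theorem nodup_roots_poly (hcoupling : ∀ i < n, 0 < T.coupling i) :
    (T.poly (n + 1)).roots.Nodup := by
  have hne : T.poly (n + 1) ≠ 0 := (Matrix.charpoly_monic _).ne_zero
  rw [Multiset.nodup_iff_count_le_one]
  intro x
  rw [count_roots]
  by_contra! hmult
  obtain ⟨hroot, hderiv⟩ := (one_lt_rootMultiplicity_iff_isRoot hne).1 hmult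
  have hkernel := T.kernel_self n x
  rw [hroot.eq_zero, hderiv.eq_zero, zero_mul, mul_zero, sub_zero] at hkernel
  exact (kernel_self_pos hcoupling x).ne' hkernel

/-- `E` lists the eigenvalues of the leading block of size `n + 1`, all of them real and simple, in
decreasing order. -/
def IsSpectrum (T : Tridiagonal ℝ) (n : ℕ) (E : Fin (n + 1) → ℝ) : Prop :=
  StrictAnti E ∧ T.poly (n + 1) = ∏ j, (X - C (E j))

theorem exists_isSpectrum (hcoupling : ∀ i < n, 0 < T.coupling i) : ∃ E, T.IsSpectrum n E :=
  exists_strictAnti_eq_prod_X_sub_C (Matrix.charpoly_monic _)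
    (splits_poly fun i hi => (hcoupling i (Nat.lt_of_succ_lt_succ hi)).le)
    (nodup_roots_poly hcoupling) ((Matrix.charpoly_natDegree_eq_dim _).trans (Fintype.card_fin _))

end Real

section Field

variable {K : Type*} [Field K] (T : Tridiagonal K) {n : ℕ} {e : K}

/-- The formal solution `f` of `T f = e f` on `ℕ` with `f 0 = 1`. -/
def solution (e : K) (k : ℕ) : K := (T.poly k).eval e * ∏ i ∈ Finset.range k, (T.sup i)⁻¹

@[simp]
theorem solution_zero (e : K) : T.solution e 0 = 1 := by simp [solution]

variable {T}

theorem solution_map {L : Type*} [Field L] (φ : K →+* L) (e : K) (k : ℕ) :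
    (T.map φ).solution (φ e) k = φ (T.solution e k) := by
  rw [solution, poly_map, eval_map_apply, solution, map_mul, map_prod]
  simp only [map_inv₀, map]

theorem sup_mul_solution_succ {k : ℕ} (hk : T.sup k ≠ 0) :
    T.sup k * T.solution e (k + 1) =
      (T.poly (k + 1)).eval e * ∏ i ∈ Finset.range k, (T.sup i)⁻¹ := by
  rw [solution, Finset.prod_range_succ]
  field_simp

theorem sub_mul_solution_add_two {k : ℕ} (hk : T.sup k ≠ 0) :
    T.sub (k + 1) * T.solution e k + T.diag (k + 1) * T.solution e (k + 1) +
      (T.poly (k + 2)).eval e * ∏ i ∈ Finset.range (k + 1), (T.sup i)⁻¹ =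
        e * T.solution e (k + 1) := by
  simp only [solution, Finset.prod_range_succ, poly_add_two, coupling, eval_sub, eval_mul, eval_X,
    eval_C]
  field_simp
  ring

theorem mulVec_solution (hsup : ∀ i < n, T.sup i ≠ 0) (he : (T.poly (n + 1)).IsRoot e) :
    T.matrix (n + 1) *ᵥ (fun k => T.solution e k) = e • fun k : Fin (n + 1) => T.solution e k := by
  have hrow (k : ℕ) (hk : k ≤ n) : (if 0 < k then T.sub k * T.solution e (k - 1) else 0) +
      T.diag k * T.solution e k + (T.poly (k + 1)).eval e * ∏ i ∈ Finset.range k, (T.sup i)⁻¹ =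
        e * T.solution e k := by
    obtain _ | k := k
    · simp [poly_one]
    · simpa using sub_mul_solution_add_two (hsup k hk)
  funext k
  have hnext : (if (k : ℕ) < n then T.sup k * T.solution e (k + 1) else 0) =
      (T.poly (k + 1)).eval e * ∏ i ∈ Finset.range k, (T.sup i)⁻¹ := by
    split_ifs with hk
    · exact sup_mul_solution_succ (hsup k hk)
    · rw [show (k : ℕ) = n by omega, he.eq_zero, zero_mul]
  rw [mulVec_apply, Pi.smul_apply, smul_eq_mul, ← hrow k (Nat.le_of_lt_succ k.is_lt), ← hnext]
  simp only [dite_eq_ite]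
  ring

theorem eq_zero_of_mulVec_eq_smul {f : Fin (n + 1) → K} (hsup : ∀ i < n, T.sup i ≠ 0)
    (hf : T.matrix (n + 1) *ᵥ f = e • f) (h0 : f 0 = 0) : f = 0 := by
  have hzero : ∀ k (hk : k < n + 1), f ⟨k, hk⟩ = 0 := by
    intro k
    induction k using Nat.strong_induction_on with
    | _ k ih =>
      intro hk
      obtain _ | k := k
      · exact h0
      have hrow := congrFun hf ⟨k, by omega⟩
      rw [mulVec_apply, dif_pos (by exact Nat.lt_of_succ_lt_succ hk), Pi.smul_apply,
        ih k (by omega), ih (k - 1) (by omega)] at hrow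
      simpa [hsup k (by omega)] using hrow
  exact funext fun k => hzero k k.is_lt

theorem mulVec_eq_smul_iff {f : Fin (n + 1) → K} (hsup : ∀ i < n, T.sup i ≠ 0)
    (he : (T.poly (n + 1)).IsRoot e) :
    T.matrix (n + 1) *ᵥ f = e • f ↔ ∀ k, f k = f 0 * T.solution e k := by
  let φ : Fin (n + 1) → K := fun k => T.solution e k
  have hφ : T.matrix (n + 1) *ᵥ φ = e • φ := mulVec_solution hsup he
  have hdecomp : (∀ k, f k = f 0 * T.solution e k) ↔ f = f 0 • φ := funext_iff.symm
  rw [hdecomp]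
  refine ⟨fun hf => sub_eq_zero.1 (eq_zero_of_mulVec_eq_smul (e := e) hsup ?_ ?_), fun hf => ?_⟩
  · rw [Matrix.mulVec_sub, Matrix.mulVec_smul, hf, hφ, smul_sub, smul_comm]
  · simp [φ]
  · rw [hf, Matrix.mulVec_smul, hφ, smul_comm]

section Reversal

variable {S : Tridiagonal K}

theorem poly_eq_of_matrix_eq_reindex_rev
    (hrev : S.matrix (n + 1) = (T.matrix (n + 1)).reindex Fin.revPerm Fin.revPerm) :
    S.poly (n + 1) = T.poly (n + 1) := by
  rw [poly, hrev, Matrix.charpoly_reindex, poly]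

theorem solution_sub_eq_of_matrix_eq_reindex_rev
    (hrev : S.matrix (n + 1) = (T.matrix (n + 1)).reindex Fin.revPerm Fin.revPerm)
    (hS : ∀ i < n, S.sup i ≠ 0) (hT : ∀ i < n, T.sup i ≠ 0) (he : (T.poly (n + 1)).IsRoot e)
    {k : ℕ} (hk : k ≤ n) : S.solution e (n - k) = S.solution e n * T.solution e k := by
  have heS : (S.poly (n + 1)).IsRoot e := by rwa [poly_eq_of_matrix_eq_reindex_rev hrev]
  let ψ : Fin (n + 1) → K := (fun k : Fin (n + 1) => S.solution e k) ∘ Fin.revPerm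
  have hψ : T.matrix (n + 1) *ᵥ ψ = e • ψ := by
    have hS := mulVec_solution hS heS
    rw [hrev, Matrix.reindex_apply, Matrix.submatrix_mulVec_equiv] at hS
    funext j
    simpa [ψ] using congrFun hS j.rev
  simpa [ψ, Fin.val_rev] using (mulVec_eq_smul_iff hT he).1 hψ ⟨k, Nat.lt_succ_of_le hk⟩

theorem solution_mul_solution_of_matrix_eq_reindex_rev
    (hrev : S.matrix (n + 1) = (T.matrix (n + 1)).reindex Fin.revPerm Fin.revPerm)
    (hS : ∀ i < n, S.sup i ≠ 0) (hT : ∀ i < n, T.sup i ≠ 0) (he : (T.poly (n + 1)).IsRoot e) :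
    S.solution e n * T.solution e n = 1 := by
  rw [← solution_sub_eq_of_matrix_eq_reindex_rev hrev hS hT he le_rfl, Nat.sub_self,
    solution_zero]

end Reversal

/-- The weights that make `T` self-adjoint on the sites `0, …, n`, up to normalization. -/
def weight (T : Tridiagonal K) (n k : ℕ) : K :=
  (∏ i ∈ Finset.range k, T.sup i) * ∏ i ∈ Finset.Ico k n, T.sub (i + 1)

theorem sum_solution_mul_weight (hsup : ∀ i < n, T.sup i ≠ 0) (x y : K) :
    ∑ k ∈ Finset.range (n + 1), T.solution x k * T.solution y k * T.weight n k =
      T.kernel n x y * ∏ i ∈ Finset.range n, (T.sup i)⁻¹ := by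
  rw [kernel, Finset.sum_mul]
  refine Finset.sum_congr rfl fun k hk => ?_
  have hkn : k ≤ n := Nat.le_of_lt_succ (Finset.mem_range.1 hk)
  have hlow : ∏ i ∈ Finset.range k, T.sup i ≠ 0 :=
    Finset.prod_ne_zero_iff.2 fun i hi => hsup i ((Finset.mem_range.1 hi).trans_le hkn)
  have hhigh : ∏ i ∈ Finset.Ico k n, T.sup i ≠ 0 :=
    Finset.prod_ne_zero_iff.2 fun i hi => hsup i (Finset.mem_Ico.1 hi).2
  simp only [solution, weight, coupling, Finset.prod_mul_distrib, Finset.prod_inv_distrib,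
    ← Finset.prod_range_mul_prod_Ico T.sup hkn]
  field_simp

theorem sum_solution_mul_solution_mul_weight_of_ne {x y : K} (hsup : ∀ i < n, T.sup i ≠ 0)
    (hx : (T.poly (n + 1)).IsRoot x) (hy : (T.poly (n + 1)).IsRoot y) (hxy : x ≠ y) :
    ∑ k ∈ Finset.range (n + 1), T.solution x k * T.solution y k * T.weight n k = 0 := by
  have hkernel : T.kernel n x y = 0 := by
    have h := T.sub_mul_kernel n x y
    rw [hx.eq_zero, hy.eq_zero, zero_mul, mul_zero, sub_zero] at h
    exact (mul_eq_zero.1 h).resolve_left (sub_ne_zero.2 hxy)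
  rw [sum_solution_mul_weight hsup, hkernel, zero_mul]

theorem sum_solution_sq_mul_weight (hsup : ∀ i < n, T.sup i ≠ 0)
    (he : (T.poly (n + 1)).IsRoot e) :
    ∑ k ∈ Finset.range (n + 1), T.solution e k * T.solution e k * T.weight n k =
      (derivative (T.poly (n + 1))).eval e * T.solution e n := by
  rw [sum_solution_mul_weight hsup, kernel_self, he.eq_zero, mul_zero, sub_zero, solution,
    mul_assoc]

end Field

section Positive

variable {S T : Tridiagonal ℝ} {n : ℕ} {E : Fin (n + 1) → ℝ}

/-- The entries of the leading block of size `n + 1` next to the diagonal are positive. -/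
structure IsPositive (T : Tridiagonal ℝ) (n : ℕ) : Prop where
  sup_pos : ∀ i < n, 0 < T.sup i
  sub_pos : ∀ i < n, 0 < T.sub (i + 1)

theorem IsPositive.coupling_pos (hT : T.IsPositive n) {i : ℕ} (hi : i < n) : 0 < T.coupling i :=
  mul_pos (hT.sup_pos i hi) (hT.sub_pos i hi)

theorem IsPositive.sup_ne_zero (hT : T.IsPositive n) {i : ℕ} (hi : i < n) : T.sup i ≠ 0 :=
  (hT.sup_pos i hi).ne'

theorem IsPositive.weight_pos (hT : T.IsPositive n) {k : ℕ} (hk : k ≤ n) : 0 < T.weight n k :=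
  mul_pos (Finset.prod_pos fun i hi => hT.sup_pos i ((Finset.mem_range.1 hi).trans_le hk))
    (Finset.prod_pos fun i hi => hT.sub_pos i (Finset.mem_Ico.1 hi).2)

theorem IsSpectrum.isRoot (hE : T.IsSpectrum n E) (j : Fin (n + 1)) :
    (T.poly (n + 1)).IsRoot (E j) := by
  rw [hE.2, IsRoot.def, eval_prod]
  exact Finset.prod_eq_zero (Finset.mem_univ j) (by simp)

theorem IsSpectrum.isRoot_map_iff {K : Type*} [Field K] [Algebra ℝ K] (hE : T.IsSpectrum n E)
    {e : K} :
    ((T.map (algebraMap ℝ K)).poly (n + 1)).IsRoot e ↔ ∃ j, e = algebraMap ℝ K (E j) := by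
  rw [poly_map, hE.2, Polynomial.map_prod, IsRoot.def, eval_prod, Finset.prod_eq_zero_iff]
  simp [sub_eq_zero]

theorem IsSpectrum.exists_mulVec_eq_smul_iff {K : Type*} [Field K] [Algebra ℝ K]
    (hE : T.IsSpectrum n E) {e : K} :
    (∃ f ≠ 0, (T.map (algebraMap ℝ K)).matrix (n + 1) *ᵥ f = e • f) ↔
      ∃ j, e = algebraMap ℝ K (E j) :=
  (exists_mulVec_eq_smul_iff_isRoot_charpoly _ e).trans hE.isRoot_map_iff

theorem IsSpectrum.sum_solution_sq_mul_weight (hE : T.IsSpectrum n E) (hT : T.IsPositive n)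
    (j : Fin (n + 1)) :
    ∑ k ∈ Finset.range (n + 1), T.solution (E j) k * T.solution (E j) k * T.weight n k =
      (∏ l ∈ Finset.univ.erase j, |E j - E l|) * ((-1) ^ (j : ℕ) * T.solution (E j) n) := by
  rw [Tridiagonal.sum_solution_sq_mul_weight (fun i hi => hT.sup_ne_zero hi) (hE.isRoot j), hE.2,
    eval_derivative_prod_X_sub_C, prod_erase_sub_eq_neg_one_pow_mul hE.1]
  ring

theorem IsSpectrum.neg_one_pow_mul_solution_pos (hE : T.IsSpectrum n E) (hT : T.IsPositive n)
    (j : Fin (n + 1)) : 0 < (-1) ^ (j : ℕ) * T.solution (E j) n := by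
  have hnorm : 0 < ∑ k ∈ Finset.range (n + 1),
      T.solution (E j) k * T.solution (E j) k * T.weight n k := by
    refine Finset.sum_pos' (fun k hk => mul_nonneg (mul_self_nonneg _)
      (hT.weight_pos (Nat.le_of_lt_succ (Finset.mem_range.1 hk))).le) ⟨0, by simp, ?_⟩
    simpa using hT.weight_pos n.zero_le
  rw [hE.sum_solution_sq_mul_weight hT] at hnorm
  exact pos_of_mul_pos_right hnorm (prod_erase_abs_sub_pos hE.1.injective j).le

theorem IsSpectrum.abs_solution (hE : T.IsSpectrum n E) (hT : T.IsPositive n) (j : Fin (n + 1)) :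
    |T.solution (E j) n| = (-1) ^ (j : ℕ) * T.solution (E j) n := by
  simpa [abs_mul] using abs_of_pos (hE.neg_one_pow_mul_solution_pos hT j)

theorem IsSpectrum.solution_ne_zero (hE : T.IsSpectrum n E) (hT : T.IsPositive n)
    (j : Fin (n + 1)) : T.solution (E j) n ≠ 0 :=
  right_ne_zero_of_mul (hE.neg_one_pow_mul_solution_pos hT j).ne'

/-- The eigenvector on the sites `0, …, n` whose first and last components have product `±1`. -/
def normalizedSolution (T : Tridiagonal ℝ) (n : ℕ) (e : ℝ) (k : ℕ) : ℝ :=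
  √|(T.solution e n)⁻¹| * T.solution e k

theorem IsSpectrum.sum_normalizedSolution_mul_weight (hE : T.IsSpectrum n E) (hT : T.IsPositive n)
    (i j : Fin (n + 1)) :
    ∑ k ∈ Finset.range (n + 1),
        T.normalizedSolution n (E i) k * T.normalizedSolution n (E j) k * T.weight n k =
      if i = j then ∏ l ∈ Finset.univ.erase j, |E j - E l| else 0 := by
  have hfactor : ∑ k ∈ Finset.range (n + 1),
        T.normalizedSolution n (E i) k * T.normalizedSolution n (E j) k * T.weight n k =
      √|(T.solution (E i) n)⁻¹| * √|(T.solution (E j) n)⁻¹| *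
        ∑ k ∈ Finset.range (n + 1), T.solution (E i) k * T.solution (E j) k * T.weight n k := by
    rw [Finset.mul_sum]
    exact Finset.sum_congr rfl fun k _ => by rw [normalizedSolution, normalizedSolution]; ring
  rw [hfactor]
  split_ifs with hij
  · rw [hij, hE.sum_solution_sq_mul_weight hT, ← hE.abs_solution hT,
      Real.mul_self_sqrt (abs_nonneg _), abs_inv]
    field_simp [abs_ne_zero.2 (hE.solution_ne_zero hT j)]
  · rw [sum_solution_mul_solution_mul_weight_of_ne (fun i hi => hT.sup_ne_zero hi) (hE.isRoot i)
      (hE.isRoot j) (hE.1.injective.ne hij), mul_zero]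

theorem IsSpectrum.sum_normalizedSolution_div (hE : T.IsSpectrum n E) (hT : T.IsPositive n)
    {l k : ℕ} (hl : l ≤ n) (hk : k ≤ n) :
    ∑ j, T.normalizedSolution n (E j) l * T.normalizedSolution n (E j) k /
        ∏ i ∈ Finset.univ.erase j, |E j - E i| =
      if l = k then (T.weight n k)⁻¹ else 0 := by
  have horth (i j : Fin (n + 1)) := hE.sum_normalizedSolution_mul_weight hT i j
  simp only [Finset.sum_range] at horth
  simpa using sum_mul_div_eq_of_sum_mul_mul_eq
    (fun j => (prod_erase_abs_sub_pos hE.1.injective j).ne') horth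
    ⟨l, Nat.lt_succ_of_le hl⟩ ⟨k, Nat.lt_succ_of_le hk⟩

theorem IsSpectrum.reverse (hE : T.IsSpectrum n E)
    (hrev : S.matrix (n + 1) = (T.matrix (n + 1)).reindex Fin.revPerm Fin.revPerm) :
    S.IsSpectrum n E :=
  ⟨hE.1, (poly_eq_of_matrix_eq_reindex_rev hrev).trans hE.2⟩

theorem IsSpectrum.normalizedSolution_reverse (hE : T.IsSpectrum n E)
    (hrev : S.matrix (n + 1) = (T.matrix (n + 1)).reindex Fin.revPerm Fin.revPerm)
    (hS : S.IsPositive n) (hT : T.IsPositive n) (j : Fin (n + 1)) {k : ℕ} (hk : k ≤ n) :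
    S.normalizedSolution n (E j) k = (-1) ^ (j : ℕ) * T.normalizedSolution n (E j) (n - k) := by
  have hsup (i : ℕ) (hi : i < n) := hT.sup_ne_zero hi
  have hsup' (i : ℕ) (hi : i < n) := hS.sup_ne_zero hi
  have hinv : (T.solution (E j) n)⁻¹ = S.solution (E j) n := inv_eq_of_mul_eq_one_left
    (solution_mul_solution_of_matrix_eq_reindex_rev hrev hsup' hsup (hE.isRoot j))
  have hshift : S.solution (E j) k = S.solution (E j) n * T.solution (E j) (n - k) := by
    simpa [Nat.sub_sub_self hk] using
      solution_sub_eq_of_matrix_eq_reindex_rev hrev hsup' hsup (hE.isRoot j) (Nat.sub_le n k)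
  have hsign : S.solution (E j) n =
      (-1) ^ (j : ℕ) * (√|S.solution (E j) n| * √|S.solution (E j) n|) := by
    rw [Real.mul_self_sqrt (abs_nonneg _), (hE.reverse hrev).abs_solution hS, ← mul_assoc,
      ← mul_pow, neg_one_mul, neg_neg, one_pow, one_mul]
  have hsqrt : √|S.solution (E j) n| ≠ 0 :=
    Real.sqrt_ne_zero'.2 (abs_pos.2 ((hE.reverse hrev).solution_ne_zero hS j))
  rw [normalizedSolution, normalizedSolution, hinv, hshift, abs_inv, Real.sqrt_inv]
  nth_rw 2 [hsign]
  field_simp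

end Positive

end Tridiagonal

namespace DiscreteHeun

theorem perm_one_zero : perm 1 0 = 1 := by decide

theorem perm_one_one : perm 1 1 = 0 := by decide

theorem perm_one_two : perm 1 2 = 3 := by decide

theorem perm_one_three : perm 1 3 = 2 := by decide

theorem perm_one_eq_zero_or_one {r : Fin 4} (hr : r = 0 ∨ r = 1) :
    perm 1 r = 0 ∨ perm 1 r = 1 := by
  decide +revert

theorem perm_one_perm_one (r : Fin 4) : perm 1 (perm 1 r) = r := by decide +revert

theorem perm_perm_one (r s : Fin 4) : perm (perm 1 r) s = perm 1 (perm r s) := by decide +revert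

section Theta

variable {p : ℝ}

/-- The infinite product common to the four theta functions: `m = 2` for `θ₁` and `θ₂`, `m = 1` for
`θ₃` and `θ₄`, and `c = ± cos 2z`. -/
def thetaProd (p : ℝ) (m : ℕ) (c : ℝ) : ℝ :=
  ∏' n : ℕ, (1 - p ^ (2 * (n + 1))) * (1 + 2 * p ^ (2 * n + m) * c + (p ^ (2 * n + m)) ^ 2)

theorem theta1_eq_thetaProd (p z : ℝ) :
    theta1 p z = 2 * p ^ (1 / 4 : ℝ) * Real.sin z * thetaProd p 2 (-Real.cos (2 * z)) := by
  rw [theta1, thetaProd]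
  congr 1
  exact tprod_congr fun n => by ring

theorem theta2_eq_thetaProd (p z : ℝ) :
    theta2 p z = 2 * p ^ (1 / 4 : ℝ) * Real.cos z * thetaProd p 2 (Real.cos (2 * z)) := by
  rw [theta2, thetaProd]
  congr 1
  exact tprod_congr fun n => by ring

theorem theta3_eq_thetaProd (p z : ℝ) : theta3 p z = thetaProd p 1 (Real.cos (2 * z)) :=
  tprod_congr fun n => by ring

theorem theta4_eq_thetaProd (p z : ℝ) : theta4 p z = thetaProd p 1 (-Real.cos (2 * z)) :=
  tprod_congr fun n => by ring

theorem norm_thetaProd_factor_sub_one_le (hp0 : 0 < p) (hp1 : p < 1) (m : ℕ) {c : ℝ}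
    (hc : c ∈ Set.Icc (-1) 1) (n : ℕ) :
    ‖(1 - p ^ (2 * (n + 1))) * (1 + 2 * p ^ (2 * n + m) * c + (p ^ (2 * n + m)) ^ 2) - 1‖ ≤
      4 * p ^ n := by
  have hr : p ^ (2 * (n + 1)) ≤ p ^ n := pow_le_pow_of_le_one hp0.le hp1.le (by omega)
  have hq : p ^ (2 * n + m) ≤ p ^ n := pow_le_pow_of_le_one hp0.le hp1.le (by omega)
  have hr1 : p ^ (2 * (n + 1)) ≤ 1 := pow_le_one₀ hp0.le hp1.le
  have hq1 : p ^ (2 * n + m) ≤ 1 := pow_le_one₀ hp0.le hp1.le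
  have hr0 : 0 < p ^ (2 * (n + 1)) := by positivity
  have hq0 : 0 < p ^ (2 * n + m) := by positivity
  set r := p ^ (2 * (n + 1))
  set q := p ^ (2 * n + m)
  have hquad : |2 * q * c + q ^ 2| ≤ 3 * q := by
    rw [abs_le]
    constructor <;> nlinarith [hc.1, hc.2]
  calc
    ‖(1 - r) * (1 + 2 * q * c + q ^ 2) - 1‖ = |(1 - r) * (2 * q * c + q ^ 2) - r| := by
      rw [Real.norm_eq_abs]
      congr 1
      ring
    _ ≤ (1 - r) * |2 * q * c + q ^ 2| + r := by
      refine (abs_sub _ _).trans_eq ?_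
      rw [abs_mul, abs_of_pos hr0, abs_of_nonneg (sub_nonneg.2 hr1)]
    _ ≤ 1 * (3 * q) + r := by
      gcongr
      linarith
    _ ≤ 4 * p ^ n := by linarith

theorem thetaProd_pos (hp0 : 0 < p) (hp1 : p < 1) {m : ℕ} (hm : m ≠ 0) {c : ℝ}
    (hc : c ∈ Set.Icc (-1) 1) : 0 < thetaProd p m c := by
  have hfactor (n : ℕ) : 0 < (1 - p ^ (2 * (n + 1))) *
      (1 + 2 * p ^ (2 * n + m) * c + (p ^ (2 * n + m)) ^ 2) := by
    have hr : p ^ (2 * (n + 1)) < 1 := pow_lt_one₀ hp0.le hp1 (by omega)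
    have hq : p ^ (2 * n + m) < 1 := pow_lt_one₀ hp0.le hp1 (by omega)
    have hq0 : 0 < p ^ (2 * n + m) := by positivity
    exact mul_pos (sub_pos.2 hr) (by nlinarith [hc.1, mul_pos (sub_pos.2 hq) (sub_pos.2 hq)])
  have hsummable : Summable fun n => (1 - p ^ (2 * (n + 1))) *
      (1 + 2 * p ^ (2 * n + m) * c + (p ^ (2 * n + m)) ^ 2) - 1 :=
    Summable.of_norm_bounded ((summable_geometric_of_lt_one hp0.le hp1).mul_left 4)
      (norm_thetaProd_factor_sub_one_le hp0 hp1 m hc)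
  have hlog := Real.summable_log_one_add_of_summable hsummable
  simp only [add_sub_cancel] at hlog
  rw [thetaProd, ← Real.rexp_tsum_eq_tprod hfactor hlog]
  exact Real.exp_pos _

theorem continuousOn_thetaProd (hp0 : 0 < p) (hp1 : p < 1) (m : ℕ) :
    ContinuousOn (thetaProd p m) (Set.Icc (-1) 1) := by
  have h := Summable.hasProdUniformlyOn_nat_one_add
    (f := fun n c => (1 - p ^ (2 * (n + 1))) *
      (1 + 2 * p ^ (2 * n + m) * c + (p ^ (2 * n + m)) ^ 2) - 1)
    (isCompact_Icc (a := (-1 : ℝ)) (b := 1))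
    ((summable_geometric_of_lt_one hp0.le hp1).mul_left 4)
    (Filter.Eventually.of_forall fun n c hc =>
      norm_thetaProd_factor_sub_one_le hp0 hp1 m hc n) (fun n => by fun_prop)
  simp only [add_sub_cancel] at h
  exact (hasProdUniformlyOn_iff_tendstoUniformlyOn.1 h).continuousOn
    (Filter.Frequently.of_forall fun s => by fun_prop)

theorem neg_cos_mem_Icc (x : ℝ) : -Real.cos x ∈ Set.Icc (-1) 1 :=
  ⟨neg_le_neg (Real.cos_le_one x), neg_le.1 (Real.neg_one_le_cos x)⟩

/-- The four theta functions as a family, indexed as in `bracket`. -/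
def theta (p : ℝ) : Fin 4 → ℝ → ℝ := ![theta1 p, theta2 p, theta3 p, theta4 p]

theorem theta_pos (hp0 : 0 < p) (hp1 : p < 1) {r : Fin 4} {z : ℝ} (hsin : r = 0 → 0 < Real.sin z)
    (hcos : r = 1 → 0 < Real.cos z) : 0 < theta p r z := by
  have hprod {m : ℕ} (hm : m ≠ 0) := thetaProd_pos hp0 hp1 hm (Real.cos_mem_Icc (2 * z))
  have hprod' {m : ℕ} (hm : m ≠ 0) := thetaProd_pos hp0 hp1 hm (neg_cos_mem_Icc (2 * z))
  have hpow : 0 < 2 * p ^ (1 / 4 : ℝ) := by positivity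
  match r with
  | 0 =>
    exact (mul_pos (mul_pos hpow (hsin rfl)) (hprod' two_ne_zero)).trans_eq
      (theta1_eq_thetaProd p z).symm
  | 1 =>
    exact (mul_pos (mul_pos hpow (hcos rfl)) (hprod two_ne_zero)).trans_eq
      (theta2_eq_thetaProd p z).symm
  | 2 => exact (hprod one_ne_zero).trans_eq (theta3_eq_thetaProd p z).symm
  | 3 => exact (hprod' one_ne_zero).trans_eq (theta4_eq_thetaProd p z).symm

theorem deriv_theta1_zero_pos (hp0 : 0 < p) (hp1 : p < 1) : 0 < deriv (theta1 p) 0 := by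
  have hcont : Continuous fun z => thetaProd p 2 (-Real.cos (2 * z)) :=
    (continuousOn_thetaProd hp0 hp1 2).comp_continuous (by fun_prop) fun z => neg_cos_mem_Icc _
  have hderiv : HasDerivAt (theta1 p)
      (2 * p ^ (1 / 4 : ℝ) * Real.cos 0 * thetaProd p 2 (-Real.cos (2 * 0))) 0 := by
    rw [funext (theta1_eq_thetaProd p)]
    exact hasDerivAt_mul_of_eq_zero ((Real.hasDerivAt_sin 0).const_mul _) (by simp)
      hcont.continuousAt
  rw [hderiv.deriv, Real.cos_zero, mul_one]
  exact mul_pos (by positivity) (thetaProd_pos hp0 hp1 two_ne_zero (neg_cos_mem_Icc _))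

theorem theta_neg_div_theta_neg (p : ℝ) (r : Fin 4) (z w : ℝ) :
    theta p r (-z) / theta p r (-w) = theta p r z / theta p r w := by
  fin_cases r <;>
    simp [theta, theta1_eq_thetaProd, theta2_eq_thetaProd, theta3_eq_thetaProd,
      theta4_eq_thetaProd, neg_div_neg_eq]

theorem theta_add_pi_div_two_div_theta (p : ℝ) (r : Fin 4) (z w : ℝ) :
    theta p r (z + Real.pi / 2) / theta p r (w + Real.pi / 2) =
      theta p (perm 1 r) z / theta p (perm 1 r) w := by
  have hcos (z : ℝ) : Real.cos (2 * (z + Real.pi / 2)) = -Real.cos (2 * z) := by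
    rw [mul_add, mul_div_cancel₀ _ two_ne_zero, Real.cos_add_pi]
  fin_cases r <;>
    simp [theta, perm_one_zero, perm_one_one, perm_one_two, perm_one_three, theta1_eq_thetaProd,
      theta2_eq_thetaProd, theta3_eq_thetaProd, theta4_eq_thetaProd, hcos,
      Real.sin_add_pi_div_two, Real.cos_add_pi_div_two, neg_div_neg_eq]

end Theta

namespace Params

variable {P : Params}

theorem Admissible.α_pos (hP : P.Admissible) : 0 < P.α := by
  have h0 := hP.U_pos 0 (Or.inl rfl)
  have h1 := hP.U_pos 1 (Or.inr rfl)
  exact div_pos Real.pi_pos (by positivity)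

/-- The half-period `π / α = u₁ + u₂ + M` of the scaled theta functions. -/
def halfPeriod (P : Params) : ℝ := P.U 0 + P.U 1 + P.M

theorem Admissible.α_mul_halfPeriod (hP : P.Admissible) : P.α * P.halfPeriod = Real.pi := by
  have h0 := hP.U_pos 0 (Or.inl rfl)
  have h1 := hP.U_pos 1 (Or.inr rfl)
  exact div_mul_cancel₀ _ (by positivity)

/-- The denominators of the scaled theta functions. -/
def brNorm (P : Params) : Fin 4 → ℝ :=
  ![P.α / 2 * deriv (theta1 P.p) 0, theta2 P.p 0, theta3 P.p 0, theta4 P.p 0]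

theorem br_eq_theta_div (P : Params) (r : Fin 4) (z : ℝ) :
    P.br r z = theta P.p r (P.α / 2 * z) / P.brNorm r := by
  fin_cases r <;> rfl

theorem Admissible.brNorm_pos (hP : P.Admissible) (r : Fin 4) : 0 < P.brNorm r := by
  have htheta (s : Fin 4) (hs : s ≠ 0) : 0 < theta P.p s 0 :=
    theta_pos hP.p_pos hP.p_lt_one (fun h => absurd h hs) (fun _ => by simp)
  match r with
  | 0 => exact mul_pos (half_pos hP.α_pos) (deriv_theta1_zero_pos hP.p_pos hP.p_lt_one)
  | 1 => exact htheta 1 (by decide)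
  | 2 => exact htheta 2 (by decide)
  | 3 => exact htheta 3 (by decide)

theorem Admissible.br_div_br (hP : P.Admissible) (r : Fin 4) (z w : ℝ) :
    P.br r z / P.br r w = theta P.p r (P.α / 2 * z) / theta P.p r (P.α / 2 * w) := by
  rw [br_eq_theta_div, br_eq_theta_div, div_div_div_cancel_right₀ (hP.brNorm_pos r).ne']

theorem Admissible.br_neg_div_br_neg (hP : P.Admissible) (r : Fin 4) (z w : ℝ) :
    P.br r (-z) / P.br r (-w) = P.br r z / P.br r w := by
  rw [hP.br_div_br, hP.br_div_br, mul_neg, mul_neg, theta_neg_div_theta_neg]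

theorem Admissible.br_add_halfPeriod_div (hP : P.Admissible) (r : Fin 4) (z w : ℝ) :
    P.br r (z + P.halfPeriod) / P.br r (w + P.halfPeriod) =
      P.br (perm 1 r) z / P.br (perm 1 r) w := by
  have hshift (z : ℝ) : P.α / 2 * (z + P.halfPeriod) = P.α / 2 * z + Real.pi / 2 := by
    rw [← hP.α_mul_halfPeriod]
    ring
  rw [hP.br_div_br, hP.br_div_br, hshift, hshift, theta_add_pi_div_two_div_theta]

theorem Admissible.br_pos (hP : P.Admissible) {r : Fin 4} {z : ℝ}
    (h0 : r = 0 → z ∈ Set.Ioo 0 (2 * P.halfPeriod))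
    (h1 : r = 1 → z ∈ Set.Ioo (-P.halfPeriod) P.halfPeriod) : 0 < P.br r z := by
  have hα := hP.α_pos
  have hπ := hP.α_mul_halfPeriod
  rw [br_eq_theta_div]
  refine div_pos (theta_pos hP.p_pos hP.p_lt_one (fun hr => ?_) fun hr => ?_) (hP.brNorm_pos r)
  · obtain ⟨hz0, hz1⟩ := h0 hr
    exact Real.sin_pos_of_pos_of_lt_pi (by positivity) (by nlinarith)
  · obtain ⟨hz0, hz1⟩ := h1 hr
    exact Real.cos_pos_of_mem_Ioo ⟨by nlinarith, by nlinarith⟩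

theorem Admissible.A_pos (hP : P.Admissible) {t : ℝ} (h0 : 0 ≤ t) (h1 : t + 1 ≤ P.M) :
    0 < P.A (P.U 0 + t) := by
  have hu0 := hP.U_pos 0 (Or.inl rfl)
  have hu1 := hP.U_pos 1 (Or.inr rfl)
  obtain ⟨hv0, hv0'⟩ := abs_lt.1 (hP.V_lt 0 (Or.inl rfl))
  obtain ⟨hv1, hv1'⟩ := abs_lt.1 (hP.V_lt 1 (Or.inr rfl))
  have hhalf : P.halfPeriod = P.U 0 + P.U 1 + P.M := rfl
  refine Finset.prod_pos fun r _ => mul_pos (div_pos ?_ ?_) (div_pos ?_ ?_)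
  all_goals
    refine hP.br_pos ?_ ?_ <;> rintro rfl <;> constructor <;> linarith

theorem Admissible.aTilde_pos (hP : P.Admissible) {k : ℕ} (hk0 : 1 ≤ k) (hkM : k ≤ P.M) :
    0 < P.aTilde k := by
  have hk0' : (1 : ℝ) ≤ k := by exact_mod_cast hk0
  have hkM' : (k : ℝ) ≤ P.M := by exact_mod_cast hkM
  rw [aTilde, add_sub_assoc]
  exact hP.A_pos (by linarith) (by linarith)

theorem swap_swap (P : Params) : P.swap.swap = P := by
  simp only [swap, perm_one_perm_one]

theorem swap_α (P : Params) : P.swap.α = P.α := by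
  simp only [α, swap, perm_one_zero, perm_one_one, add_comm]

theorem swap_br (P : Params) : P.swap.br = P.br := by
  funext r z
  rw [br, br, swap_α]
  rfl

theorem swap_c (P : Params) (r : Fin 4) : P.swap.c r = P.c (perm 1 r) := by
  simp only [c, swap_br, perm_perm_one]
  rfl

theorem Admissible.swap (hP : P.Admissible) : P.swap.Admissible where
  p_pos := hP.p_pos
  p_lt_one := hP.p_lt_one
  U_pos r hr := hP.U_pos _ (perm_one_eq_zero_or_one hr)
  V_lt r hr := hP.V_lt _ (perm_one_eq_zero_or_one hr)
  u_ne := by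
    rw [swap_α]
    exact hP.u_ne
  u_add_one_ne := by
    rw [swap_α]
    exact hP.u_add_one_ne

theorem Admissible.swap_A_add_halfPeriod (hP : P.Admissible) (z : ℝ) :
    P.swap.A (z + P.halfPeriod) = P.A z := by
  refine Eq.trans ?_ (Equiv.prod_comp (perm 1) _)
  refine Finset.prod_congr rfl fun r _ => ?_
  rw [swap_br, ← hP.br_add_halfPeriod_div, ← hP.br_add_halfPeriod_div]
  simp only [Params.swap]
  congr 3 <;> ring_nf

theorem Admissible.swap_B_add_halfPeriod (hP : P.Admissible) (z : ℝ) :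
    P.swap.B (z + P.halfPeriod) = P.B z := by
  refine Eq.trans ?_ (Equiv.sum_comp (perm 1) _)
  refine Finset.sum_congr rfl fun r _ => ?_
  rw [swap_br, ← hP.br_add_halfPeriod_div, ← hP.br_add_halfPeriod_div, swap_c]
  simp only [Params.swap]
  congr 3 <;> ring_nf

theorem Admissible.B_neg (hP : P.Admissible) (z : ℝ) : P.B (-z) = P.B z := by
  refine Finset.sum_congr rfl fun r _ => ?_
  rw [← hP.br_neg_div_br_neg r (z + 1 / 2 + P.u), ← hP.br_neg_div_br_neg r (z - 1 / 2 - P.u),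
    mul_right_comm]
  congr 4 <;> ring

theorem Admissible.swap_aTilde (hP : P.Admissible) (k : ℕ) : P.swap.aTilde k = P.a k := by
  rw [a, ← hP.swap_A_add_halfPeriod, aTilde]
  congr 1
  simp only [Params.swap, perm_one_zero, halfPeriod]
  ring

theorem Admissible.swap_a (hP : P.Admissible) (k : ℕ) : P.swap.a k = P.aTilde k := by
  rw [← hP.swap.swap_aTilde, swap_swap]

theorem Admissible.swap_b (hP : P.Admissible) {k : ℕ} (hk : k ≤ P.M) :
    P.swap.b k = P.b (P.M - k) := by
  rw [b, b, ← hP.B_neg, ← hP.swap_B_add_halfPeriod]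
  congr 1
  simp only [Params.swap, perm_one_zero, halfPeriod]
  push_cast [hk]
  ring

theorem Admissible.a_pos (hP : P.Admissible) {k : ℕ} (hk0 : 1 ≤ k) (hkM : k ≤ P.M) :
    0 < P.a k := by
  rw [← hP.swap_aTilde]
  exact hP.swap.aTilde_pos hk0 hkM

/-- The tridiagonal coefficients of the finite discrete Heun equation. -/
def operator (P : Params) : Tridiagonal ℝ where
  diag := P.b
  sup i := P.aTilde (P.M - i)
  sub := P.a

theorem Admissible.isPositive_operator (hP : P.Admissible) : P.operator.IsPositive P.M where
  sup_pos i hi := hP.aTilde_pos (by omega) (by omega)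
  sub_pos i hi := hP.a_pos (by omega) (by omega)

theorem block_eq_operator_matrix (P : Params) (n : ℕ) : P.block n = P.operator.matrix n := rfl

theorem racah_eq_operator_poly (P : Params) (n : ℕ) : P.racah n = P.operator.poly n := by
  rw [racah, block_eq_operator_matrix, Tridiagonal.poly]

theorem isSpectrum_iff_operator_isSpectrum {E : Fin (P.M + 1) → ℝ} :
    P.IsSpectrum E ↔ P.operator.IsSpectrum P.M E := by
  rw [IsSpectrum, racah_eq_operator_poly, Tridiagonal.IsSpectrum]

theorem Admissible.exists_isSpectrum (hP : P.Admissible) :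
    ∃ E : Fin (P.M + 1) → ℝ, P.IsSpectrum E := by
  simp only [isSpectrum_iff_operator_isSpectrum]
  exact Tridiagonal.exists_isSpectrum fun i hi => hP.isPositive_operator.coupling_pos hi

theorem Admissible.swap_operator_matrix (hP : P.Admissible) :
    P.swap.operator.matrix (P.M + 1) =
      (P.operator.matrix (P.M + 1)).reindex Fin.revPerm Fin.revPerm := by
  ext i j
  have hM : P.swap.M = P.M := rfl
  simp only [Tridiagonal.matrix, Tridiagonal.entry, operator, Matrix.of_apply,
    Matrix.reindex_apply, Matrix.submatrix_apply, Fin.revPerm_symm, Fin.revPerm_apply, Fin.val_rev,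
    hP.swap_aTilde, hP.swap_a, hM]
  split_ifs <;> first | omega | rfl | skip
  · rw [hP.swap_b (by omega)]
    congr 1
    omega
  · congr 1
    omega
  · congr 1
    omega

variable {E : Fin (P.M + 1) → ℝ}

theorem IsSpectrum.operator (hE : P.IsSpectrum E) : P.operator.IsSpectrum P.M E :=
  isSpectrum_iff_operator_isSpectrum.1 hE

theorem prod_range_operator_sup (P : Params) :
    ∏ i ∈ Finset.range P.M, P.operator.sup i = ∏ k ∈ Finset.Icc 1 P.M, P.aTilde k := by
  rw [Finset.range_eq_Ico, ← Finset.Ico_add_one_right_eq_Icc]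
  simpa [operator] using Finset.prod_Ico_reflect P.aTilde 0 P.M.le_succ

theorem weight_eq_operator_weight (P : Params) (k : ℕ) :
    P.weight k = P.operator.weight P.M k := by
  have hsup := Finset.prod_Ico_add' (fun i => P.aTilde (P.M + 1 - i)) 0 k 1
  have hsub := Finset.prod_Ico_add' P.a k P.M 1
  simp only [Nat.add_sub_add_right, Nat.Ico_zero_eq_range, zero_add] at hsup
  rw [weight, ← Finset.Ico_add_one_right_eq_Icc, ← Finset.Ico_add_one_right_eq_Icc, ← hsup, ← hsub]
  rfl

theorem Admissible.eps_eq_swap_solution (hP : P.Admissible) (e : ℝ) :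
    P.eps e = P.swap.operator.solution e P.M := by
  simp only [eps, ← hP.swap_aTilde]
  rw [Tridiagonal.solution, Finset.prod_inv_distrib, ← div_eq_mul_inv, racah_eq_operator_poly]
  exact congrArg _ P.swap.prod_range_operator_sup.symm

theorem Admissible.eps_eq_inv_solution (hP : P.Admissible) (hE : P.IsSpectrum E)
    (j : Fin (P.M + 1)) : P.eps (E j) = (P.operator.solution (E j) P.M)⁻¹ := by
  rw [hP.eps_eq_swap_solution]
  exact eq_inv_of_mul_eq_one_left <|
    Tridiagonal.solution_mul_solution_of_matrix_eq_reindex_rev hP.swap_operator_matrix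
      (fun _ => hP.swap.isPositive_operator.sup_ne_zero)
      (fun _ => hP.isPositive_operator.sup_ne_zero) (hE.operator.isRoot j)

theorem Admissible.eps_eq_prod_div (hP : P.Admissible) (hE : P.IsSpectrum E)
    (j : Fin (P.M + 1)) :
    P.eps (E j) = (∏ k ∈ Finset.Icc 1 P.M, P.aTilde k) / (P.racah P.M).eval (E j) := by
  rw [hP.eps_eq_inv_solution hE, Tridiagonal.solution, Finset.prod_inv_distrib,
    prod_range_operator_sup, ← div_eq_mul_inv, inv_div, racah_eq_operator_poly]

theorem Admissible.eval_racah_ne_zero (hP : P.Admissible) (hE : P.IsSpectrum E)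
    (j : Fin (P.M + 1)) : (P.racah P.M).eval (E j) ≠ 0 := by
  rw [racah_eq_operator_poly]
  exact left_ne_zero_of_mul (hE.operator.solution_ne_zero hP.isPositive_operator j)

theorem heun_zero (P : Params) (e : ℝ) : P.heun e 0 = √|P.eps e| := by
  simp [heun, racah_eq_operator_poly]

theorem Admissible.heun_zero_ne_zero (hP : P.Admissible) (hE : P.IsSpectrum E)
    (j : Fin (P.M + 1)) : P.heun (E j) 0 ≠ 0 := by
  rw [heun_zero, hP.eps_eq_inv_solution hE, Real.sqrt_ne_zero', abs_pos]
  exact inv_ne_zero (hE.operator.solution_ne_zero hP.isPositive_operator j)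

theorem heun_eq_heun_zero_mul_solution (P : Params) (e : ℝ) (k : ℕ) :
    P.heun e k = P.heun e 0 * P.operator.solution e k := by
  rw [heun_zero, heun, mul_assoc, racah_eq_operator_poly, Tridiagonal.solution]
  rfl

theorem Admissible.heun_eq_normalizedSolution (hP : P.Admissible) (hE : P.IsSpectrum E)
    (j : Fin (P.M + 1)) (k : ℕ) :
    P.heun (E j) k = P.operator.normalizedSolution P.M (E j) k := by
  rw [heun_eq_heun_zero_mul_solution, heun_zero, hP.eps_eq_inv_solution hE,
    Tridiagonal.normalizedSolution]

theorem isSolution_iff_mulVec_eq_smul {e : ℂ} {f : Fin (P.M + 1) → ℂ} :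
    P.IsSolution e f ↔ (P.operator.map (algebraMap ℝ ℂ)).matrix (P.M + 1) *ᵥ f = e • f := by
  simp only [funext_iff, Tridiagonal.mulVec_apply]
  rfl

theorem IsSpectrum.exists_isSolution_iff (hE : P.IsSpectrum E) (e : ℂ) :
    (∃ f ≠ 0, P.IsSolution e f) ↔ ∃ j, e = E j := by
  simp only [isSolution_iff_mulVec_eq_smul]
  exact hE.operator.exists_mulVec_eq_smul_iff

theorem Admissible.isSolution_iff_exists_eq_mul_heun (hP : P.Admissible) (hE : P.IsSpectrum E)
    (j : Fin (P.M + 1)) (f : Fin (P.M + 1) → ℂ) :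
    P.IsSolution (E j) f ↔ ∃ t : ℂ, ∀ k, f k = t * P.heun (E j) k := by
  have hsup (i : ℕ) (hi : i < P.M) : (P.operator.map (algebraMap ℝ ℂ)).sup i ≠ 0 :=
    Complex.ofReal_ne_zero.2 (hP.isPositive_operator.sup_ne_zero hi)
  have hroot := (hE.operator.isRoot_map_iff (K := ℂ)).2 ⟨j, rfl⟩
  have hheun (k : ℕ) : (P.heun (E j) k : ℂ) =
      P.heun (E j) 0 * (P.operator.map (algebraMap ℝ ℂ)).solution (E j : ℂ) k := by
    rw [heun_eq_heun_zero_mul_solution, Complex.ofReal_mul]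
    exact congrArg _ (Tridiagonal.solution_map (algebraMap ℝ ℂ) (E j) k).symm
  have h0 : (P.heun (E j) 0 : ℂ) ≠ 0 := Complex.ofReal_ne_zero.2 (hP.heun_zero_ne_zero hE j)
  rw [isSolution_iff_mulVec_eq_smul]
  refine (Tridiagonal.mulVec_eq_smul_iff hsup hroot).trans ⟨fun h => ?_, ?_⟩
  · refine ⟨f 0 / P.heun (E j) 0, fun k => ?_⟩
    rw [hheun k, ← mul_assoc, div_mul_cancel₀ _ h0]
    exact h k
  · rintro ⟨t, ht⟩ k
    rw [ht k, ht 0, hheun k, ← mul_assoc]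
    rfl

theorem Admissible.swap_isSpectrum (hP : P.Admissible) (hE : P.IsSpectrum E) :
    P.swap.IsSpectrum E :=
  isSpectrum_iff_operator_isSpectrum.2 (hE.operator.reverse hP.swap_operator_matrix)

theorem Admissible.swap_heun (hP : P.Admissible) (hE : P.IsSpectrum E) (j : Fin (P.M + 1))
    {k : ℕ} (hk : k ≤ P.M) :
    P.swap.heun (E j) k = (-1) ^ (j : ℕ) * P.heun (E j) (P.M - k) := by
  rw [hP.heun_eq_normalizedSolution hE]
  refine (hP.swap.heun_eq_normalizedSolution (hP.swap_isSpectrum hE) j k).trans ?_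
  exact hE.operator.normalizedSolution_reverse hP.swap_operator_matrix
    hP.swap.isPositive_operator hP.isPositive_operator j hk

theorem Admissible.sum_heun_mul_heun_mul_weight (hP : P.Admissible) (hE : P.IsSpectrum E)
    (i j : Fin (P.M + 1)) :
    ∑ k ∈ Finset.range (P.M + 1), P.heun (E i) k * P.heun (E j) k * P.weight k =
      if i = j then ∏ l ∈ Finset.univ.erase j, |E j - E l| else 0 := by
  simp only [hP.heun_eq_normalizedSolution hE, weight_eq_operator_weight]
  exact hE.operator.sum_normalizedSolution_mul_weight hP.isPositive_operator i j

theorem Admissible.sum_heun_mul_heun_div (hP : P.Admissible) (hE : P.IsSpectrum E)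
    {l k : ℕ} (hl : l ≤ P.M) (hk : k ≤ P.M) :
    ∑ j, P.heun (E j) l * P.heun (E j) k / ∏ i ∈ Finset.univ.erase j, |E j - E i| =
      if l = k then (P.weight k)⁻¹ else 0 := by
  simp only [hP.heun_eq_normalizedSolution hE, weight_eq_operator_weight]
  exact hE.operator.sum_normalizedSolution_div hP.isPositive_operator hl hk

end Params

end DiscreteHeun

end

theorem theorem3p6 (P : DiscreteHeun.Params) (hP : P.Admissible) :
    ∃ E : Fin (P.M + 1) → ℝ, P.IsSpectrum E ∧
      -- (i) nontrivial solutions occur precisely at the roots of the top-degree polynomial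
      (∀ e : ℂ, (∃ f : Fin (P.M + 1) → ℂ, f ≠ 0 ∧ P.IsSolution e f) ↔ ∃ j, e = (E j : ℂ)) ∧
      -- (ii) the solutions at `E j` are the multiples of the Heun function, with its normalization
      (∀ k ∈ Finset.Icc 1 P.M, P.aTilde k ≠ 0 ∧ P.a k ≠ 0) ∧
      (∀ j, (P.racah P.M).eval (E j) ≠ 0 ∧
        P.heun (E j) 0 = √|P.eps (E j)| ∧
        √|P.eps (E j)| =
          √|(∏ k ∈ Finset.Icc 1 P.M, P.aTilde k) / (P.racah P.M).eval (E j)| ∧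
        (∀ k : ℕ, k ≤ P.M → P.heun (E j) k =
          P.heun (E j) 0 * (P.racah k).eval (E j) *
            ∏ i ∈ Finset.range k, (P.aTilde (P.M - i))⁻¹) ∧
        P.heun (E j) 0 ≠ 0 ∧
        ∀ f : Fin (P.M + 1) → ℂ, P.IsSolution (E j : ℂ) f ↔
          ∃ t : ℂ, ∀ k, f k = t * (P.heun (E j) k : ℂ)) ∧
      -- (iii) palindromic quasi-symmetry
      (∃ E' : Fin (P.M + 1) → ℝ, P.swap.IsSpectrum E' ∧
        ∀ j : Fin (P.M + 1), E' j = E j ∧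
          ∀ k : ℕ, k ≤ P.M →
            P.swap.heun (E' j) k = (-1) ^ (j : ℕ) * P.heun (E j) (P.M - k)) ∧
      -- (iv) orthogonality and dual orthogonality
      (∀ i j : Fin (P.M + 1),
        ∑ k ∈ Finset.range (P.M + 1), P.heun (E i) k * P.heun (E j) k * P.weight k =
          if i = j then ∏ l ∈ Finset.univ.erase j, |E j - E l| else 0) ∧
      (∀ l k : ℕ, l ≤ P.M → k ≤ P.M →
        ∑ j : Fin (P.M + 1), P.heun (E j) l * P.heun (E j) k /
            (∏ i ∈ Finset.univ.erase j, |E j - E i|) =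
          if l = k then (P.weight k)⁻¹ else 0) := by
  obtain ⟨E, hE⟩ := hP.exists_isSpectrum
  refine ⟨E, hE, hE.exists_isSolution_iff, fun k hk => ?_, fun j => ?_, ?_,
    hP.sum_heun_mul_heun_mul_weight hE, fun l k => hP.sum_heun_mul_heun_div hE⟩
  · obtain ⟨hk0, hkM⟩ := Finset.mem_Icc.1 hk
    exact ⟨(hP.aTilde_pos hk0 hkM).ne', (hP.a_pos hk0 hkM).ne'⟩
  · refine ⟨hP.eval_racah_ne_zero hE j, P.heun_zero _, by rw [hP.eps_eq_prod_div hE], fun k _ => ?_,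
      hP.heun_zero_ne_zero hE j, hP.isSolution_iff_exists_eq_mul_heun hE j⟩
    rw [P.heun_zero, DiscreteHeun.Params.heun]
  · exact ⟨E, hP.swap_isSpectrum hE, fun j => ⟨rfl, fun k hk => hP.swap_heun hE j hk⟩⟩
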